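/- Let $m$ and $n$ be non-negative integers with $n \geq 2$, and let $\mathcal{S}_{m,n} \subseteq \mathbb{C}^{m \times m}$ be the set of complex symmetric $m \times m$ matrices $A$ of rank at most $n$ whose diagonal entries are all equal, that is, $A_{11} = A_{22} = \cdots = A_{mm}$. Then $\mathcal{S}_{m,n}$ is an irreducible complex affine variety: it is closed in the Zariski topology of the affine space $\mathbb{C}^{m \times m}$ (so it is the common zero locus of a set of polynomials in the matrix entries), and it is irreducible, that is, it is non-empty and is not the union of two Zariski closed subsets of $\mathbb{C}^{m\times m}$ that are both properly contained in it. -/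

import Mathlib

/-- The Zariski topology on the affine space `σ → K`: the closed sets are the common zero loci
of sets of polynomials. -/
abbrev zariskiTopology (σ K : Type*) [Field K] : TopologicalSpace (σ → K) :=
  TopologicalSpace.ofClosed
    {Z : Set (σ → K) | ∃ P : Set (MvPolynomial σ K), Z = {x | ∀ p ∈ P, MvPolynomial.eval x p = 0}}
    ⟨{1}, by ext x; simp⟩
    (by
      intro A hA
      refine ⟨{p | ∀ x ∈ ⋂₀ A, MvPolynomial.eval x p = 0}, ?_⟩
      ext x
      refine ⟨fun hx p hp => hp x hx, fun hx Z hZ => ?_⟩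
      obtain ⟨P, rfl⟩ := hA hZ
      intro p hp
      exact hx p fun y hy => hy _ hZ p hp)
    (by
      rintro _ ⟨P, rfl⟩ _ ⟨Q, rfl⟩
      refine ⟨{r | ∃ p ∈ P, ∃ q ∈ Q, r = p * q}, ?_⟩
      ext x
      constructor
      · rintro (hx | hx) _ ⟨p, hp, q, hq, rfl⟩
        · simp [hx p hp]
        · simp [hx q hq]
      · intro hx
        by_contra h
        simp only [Set.mem_union, Set.mem_ofPred_eq, not_or, not_forall] at h
        obtain ⟨⟨p, hp, hp0⟩, ⟨q, hq, hq0⟩⟩ := h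
        have := hx _ ⟨p, hp, q, hq, rfl⟩
        rw [map_mul] at this
        exact (mul_ne_zero hp0 hq0) this)

/-- The Zariski topology on the space of `m × m` complex matrices, which is the affine space whose
coordinates are the `m ^ 2` entries. -/
noncomputable abbrev matrixZariskiTopology (m : ℕ) : TopologicalSpace (Matrix (Fin m) (Fin m) ℂ) :=
  TopologicalSpace.induced (fun A (p : Fin m × Fin m) => A p.1 p.2)
    (zariskiTopology (Fin m × Fin m) ℂ)

/-- A set of `m × m` complex matrices is an irreducible complex (affine) variety if it is Zariski
closed and irreducible, the latter including that it is not empty. -/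
def IsIrreducibleMatrixVariety {m : ℕ} (S : Set (Matrix (Fin m) (Fin m) ℂ)) : Prop :=
  @IsClosed _ (matrixZariskiTopology m) S ∧ @IsIrreducible _ (matrixZariskiTopology m) S

/-- The complex symmetric `m × m` matrices of rank at most `n` whose diagonal entries are all
equal. -/
def symmRankLocus (m n : ℕ) : Set (Matrix (Fin m) (Fin m) ℂ) :=
  {A | A.IsSymm ∧ A.rank ≤ n ∧ ∀ i j : Fin m, A i i = A j j}

open Matrix

/-! Closedness reduces to determinants: the rank bound says that every compression to size `n + 1`
is singular. For irreducibility, a matrix in the locus is a Gram matrix of `m` vectors in `ℂⁿ`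
(`Matrix.IsSymm.exists_gram`). As `n ≥ 2`, the form can be written `x * y + ∑ l, z l ^ 2`, and the
diagonal condition becomes `x i * y i + ∑ l, z i l ^ 2 = c`. Where no `x i` vanishes, put `x i = exp
(u i)` and solve for `y i`: the parameters `(u, c, z)` range freely over an affine space, and their
image is dense (`exists_exp_eval_hyperbolicGram_ne_zero`). A line in parameter space joins any two
such points, and polynomials restrict to entire functions along it. These form a domain, so two
nonempty open subsets meet. -/

theorem isClosed_matrixZariski_iff {m : ℕ} {S : Set (Matrix (Fin m) (Fin m) ℂ)} :
    @IsClosed _ (matrixZariskiTopology m) S ↔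
      ∃ P : Set (MvPolynomial (Fin m × Fin m) ℂ),
        S = {A | ∀ p ∈ P, MvPolynomial.eval (fun q => A q.1 q.2) p = 0} := by
  let _ := zariskiTopology (Fin m × Fin m) ℂ
  have key (T : Set (Fin m × Fin m → ℂ)) : IsClosed T ↔
      ∃ P : Set (MvPolynomial (Fin m × Fin m) ℂ),
        T = {x | ∀ p ∈ P, MvPolynomial.eval x p = 0} := by
    rw [← isOpen_compl_iff]
    change Tᶜᶜ ∈ _ ↔ _
    rw [compl_compl]
    rfl
  rw [isClosed_induced_iff]
  constructor
  · rintro ⟨T, hT, rfl⟩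
    obtain ⟨P, rfl⟩ := (key T).1 hT
    exact ⟨P, rfl⟩
  · rintro ⟨P, rfl⟩
    exact ⟨_, (key _).2 ⟨P, rfl⟩, rfl⟩

theorem isClosed_setOf_eval_eq_zero {m : ℕ} (p : MvPolynomial (Fin m × Fin m) ℂ) :
    @IsClosed _ (matrixZariskiTopology m)
      {A : Matrix (Fin m) (Fin m) ℂ | MvPolynomial.eval (fun q => A q.1 q.2) p = 0} :=
  isClosed_matrixZariski_iff.2 ⟨{p}, by simp⟩

/-- A Zariski open neighbourhood contains a basic open neighbourhood. -/
theorem exists_eval_ne_zero_of_mem_open {m : ℕ} {u : Set (Matrix (Fin m) (Fin m) ℂ)}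
    (hu : @IsOpen _ (matrixZariskiTopology m) u) {A : Matrix (Fin m) (Fin m) ℂ} (hA : A ∈ u) :
    ∃ p : MvPolynomial (Fin m × Fin m) ℂ, MvPolynomial.eval (fun q => A q.1 q.2) p ≠ 0 ∧
      ∀ B : Matrix (Fin m) (Fin m) ℂ, MvPolynomial.eval (fun q => B q.1 q.2) p ≠ 0 → B ∈ u := by
  let _ := matrixZariskiTopology m
  obtain ⟨P, hP⟩ := isClosed_matrixZariski_iff.1 hu.isClosed_compl
  have hA' : A ∉ uᶜ := fun h => h hA
  rw [hP] at hA'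
  simp only [Set.mem_ofPred_eq, not_forall] at hA'
  obtain ⟨p, hp, hpA⟩ := hA'
  refine ⟨p, hpA, fun B hB => ?_⟩
  by_contra hBu
  have : B ∈ uᶜ := hBu
  rw [hP] at this
  exact hB (this p hp)

/-- A square matrix has rank at most `n` if and only if all its compressions to size `n + 1` are
singular. -/
theorem Matrix.rank_le_iff_forall_det_eq_zero {ι K : Type*} [Fintype ι] [DecidableEq ι] [Field K]
    (A : Matrix ι ι K) (n : ℕ) :
    A.rank ≤ n ↔ ∀ (B : Matrix (Fin (n + 1)) ι K) (C : Matrix ι (Fin (n + 1)) K),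
      (B * A * C).det = 0 := by
  constructor
  · intro h B C
    by_contra hdet
    have h1 := rank_of_det_ne_zero hdet
    have h2 := (rank_mul_le_left (B * A) C).trans (rank_mul_le_right B A)
    rw [h1, Fintype.card_fin] at h2
    omega
  · intro h
    by_contra! hn
    obtain ⟨V, U, e, -, -, hVU⟩ := exists_rank_normal_form A
    -- If the rank exceeds `n`, the identity block of the normal form contains one of size `n + 1`;
    -- `f` selects its indices.
    let f : Fin (n + 1) → ι := fun i => e.symm (Sum.inl (Fin.castLE hn i))
    have h1 : V.submatrix f id * A * U.submatrix id f = (V * A * U).submatrix f f := rfl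
    have h2 : (V * A * U).submatrix f f = 1 := by
      rw [hVU]
      ext i j
      simp [f, one_apply]
    have := h (V.submatrix f id) (U.submatrix id f)
    rw [h1, h2, det_one] at this
    exact one_ne_zero this

theorem isClosed_symmRankLocus (m n : ℕ) :
    @IsClosed _ (matrixZariskiTopology m) (symmRankLocus m n) := by
  let _ := matrixZariskiTopology m
  have hsymm : IsClosed {A : Matrix (Fin m) (Fin m) ℂ | A.IsSymm} := by
    have : {A : Matrix (Fin m) (Fin m) ℂ | A.IsSymm} = ⋂ (i) (j),
        {A | MvPolynomial.eval (fun q => A q.1 q.2)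
          (MvPolynomial.X (j, i) - MvPolynomial.X (i, j) : MvPolynomial _ ℂ) = 0} := by
      ext A
      simp [Matrix.IsSymm.ext_iff, sub_eq_zero]
    rw [this]
    exact isClosed_iInter fun i => isClosed_iInter fun j => isClosed_setOf_eval_eq_zero _
  have hdiag : IsClosed {A : Matrix (Fin m) (Fin m) ℂ | ∀ i j : Fin m, A i i = A j j} := by
    have : {A : Matrix (Fin m) (Fin m) ℂ | ∀ i j : Fin m, A i i = A j j} = ⋂ (i) (j),
        {A | MvPolynomial.eval (fun q => A q.1 q.2)
          (MvPolynomial.X (i, i) - MvPolynomial.X (j, j) : MvPolynomial _ ℂ) = 0} := by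
      ext A
      simp [sub_eq_zero]
    rw [this]
    exact isClosed_iInter fun i => isClosed_iInter fun j => isClosed_setOf_eval_eq_zero _
  have hrank : IsClosed {A : Matrix (Fin m) (Fin m) ℂ | A.rank ≤ n} := by
    let M (B : Matrix (Fin (n + 1)) (Fin m) ℂ) (C : Matrix (Fin m) (Fin (n + 1)) ℂ) :
        Matrix (Fin (n + 1)) (Fin (n + 1)) (MvPolynomial (Fin m × Fin m) ℂ) :=
      (Matrix.of fun i j => MvPolynomial.C (σ := Fin m × Fin m) (B i j)) *
        (Matrix.of fun i j => MvPolynomial.X (i, j) :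
          Matrix (Fin m) (Fin m) (MvPolynomial (Fin m × Fin m) ℂ)) *
        (Matrix.of fun i j => MvPolynomial.C (σ := Fin m × Fin m) (C i j))
    have : {A : Matrix (Fin m) (Fin m) ℂ | A.rank ≤ n} = ⋂ (B) (C),
        {A | MvPolynomial.eval (fun q => A q.1 q.2) (M B C).det = 0} := by
      ext A
      simp only [Set.mem_ofPred_eq, Matrix.rank_le_iff_forall_det_eq_zero, Set.mem_iInter]
      refine forall_congr' fun B => forall_congr' fun C => ?_
      rw [RingHom.map_det]
      have : (MvPolynomial.eval fun q : Fin m × Fin m => A q.1 q.2).mapMatrix (M B C) =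
          B * A * C := by
        ext i j
        simp [M, Matrix.mul_apply]
      rw [this]
    rw [this]
    exact isClosed_iInter fun i => isClosed_iInter fun j => isClosed_setOf_eval_eq_zero _
  have h : symmRankLocus m n = {A : Matrix (Fin m) (Fin m) ℂ | A.IsSymm} ∩
      ({A | A.rank ≤ n} ∩ {A | ∀ i j : Fin m, A i i = A j j}) := rfl
  rw [h]
  exact hsymm.inter (hrank.inter hdiag)

/-- A complex symmetric matrix of rank at most `n` is the Gram matrix of vectors in `ℂⁿ` with
respect to the standard bilinear form. -/
theorem Matrix.IsSymm.exists_gram {m n : ℕ} {A : Matrix (Fin m) (Fin m) ℂ} (hA : A.IsSymm)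
    (hr : A.rank ≤ n) :
    ∃ V : Fin n → Fin m → ℂ, ∀ i j, A i j = ∑ k, V k i * V k j := by
  classical
  have _ : Invertible (2 : ℂ) := invertibleOfNonzero two_ne_zero
  have hB : (Matrix.toLinearMap₂' ℂ A).IsSymm := by
    refine ⟨fun x y => ?_⟩
    rw [toLinearMap₂'_apply', toLinearMap₂'_apply', RingHom.id_apply, dotProduct_mulVec,
      ← mulVec_transpose, hA.eq, dotProduct_comm]
  obtain ⟨v, hv⟩ := LinearMap.BilinForm.exists_orthogonal_basis hB
  let Q : Matrix (Fin m) (Fin (Module.finrank ℂ (Fin m → ℂ))) ℂ :=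
    (Pi.basisFun ℂ (Fin m)).toMatrix v
  obtain ⟨P, hQP⟩ : ∃ P : Matrix _ (Fin m) ℂ, Q * P = (1 : Matrix (Fin m) (Fin m) ℂ) :=
    ⟨v.toMatrix (Pi.basisFun ℂ (Fin m)), Module.Basis.toMatrix_mul_toMatrix_flip _ _⟩
  let d := fun i => Matrix.toLinearMap₂' ℂ A (v i) (v i)
  have hD : Qᵀ * A * Q = diagonal d := by
    ext i j
    have h1 : (Qᵀ * A * Q) i j = Matrix.toLinearMap₂' ℂ A (v i) (v j) := by
      rw [toLinearMap₂'_apply', dotProduct_mulVec]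
      rfl
    rw [h1]
    by_cases hij : i = j
    · subst hij
      simp [d]
    · rw [diagonal_apply_ne _ hij]
      exact hv hij
  have hA' : A = Pᵀ * diagonal d * P := by
    rw [← hD]
    have h2 : Pᵀ * Qᵀ = 1 := by rw [← transpose_mul, hQP, transpose_one]
    calc A = (Pᵀ * Qᵀ) * A * (Q * P) := by rw [h2, hQP, Matrix.one_mul, Matrix.mul_one]
      _ = _ := by simp only [Matrix.mul_assoc]
  have hcard : Fintype.card {i // d i ≠ 0} ≤ Fintype.card (Fin n) := by
    rw [← rank_diagonal, ← hD, Fintype.card_fin]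
    exact ((rank_mul_le_left _ _).trans (rank_mul_le_right _ _)).trans hr
  obtain ⟨e⟩ := Function.Embedding.nonempty_of_card_le hcard
  -- Square roots of the `d i` turn the diagonal form into a sum of squares; at most `n` terms
  -- survive, and the unused slots are padded with zero.
  choose s hs using fun i => IsAlgClosed.exists_pow_nat_eq (d i) two_pos
  refine ⟨fun k i => Function.extend e (fun l => s l * P l i) 0 k, fun i j => ?_⟩
  have h3 : ∑ l : {l // d l ≠ 0}, P l i * d l * P l j =
      ∑ k, Function.extend e (fun l => s l * P l i) 0 k *
        Function.extend e (fun l => s l * P l j) 0 k := by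
    refine Fintype.sum_of_injective e e.injective _ _ (fun k hk => ?_) fun l => ?_
    · rw [Function.extend_apply' _ _ _ hk, Pi.zero_apply, zero_mul]
    · rw [e.injective.extend_apply, e.injective.extend_apply, ← hs]
      ring
  have h4 : ∑ l : {l // ¬ d l ≠ 0}, P l i * d l * P l j = 0 :=
    Finset.sum_eq_zero fun l _ => by rw [not_not.1 l.2, mul_zero, zero_mul]
  have h5 := Fintype.sum_subtype_add_sum_subtype (fun l => d l ≠ 0) fun l => P l i * d l * P l j
  calc A i j = ∑ l, P l i * d l * P l j := by
        rw [hA', mul_apply]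
        simp only [mul_diagonal, transpose_apply]
    _ = _ := by
        rw [← h3, ← add_zero (∑ l : {l // d l ≠ 0}, _), ← h4]
        convert h5.symm

/-- The Gram matrix of the vectors `(x i, y i, z i)` with respect to the symmetric bilinear form
whose quadratic form is `x * y + ∑ l, z l ^ 2`. -/
noncomputable def hyperbolicGram {m k : ℕ} (x y : Fin m → ℂ) (z : Fin m → Fin k → ℂ) :
    Matrix (Fin m) (Fin m) ℂ :=
  Matrix.of fun i j => (x i * y j + y i * x j) / 2 + ∑ l, z i l * z j l

theorem hyperbolicGram_mem_symmRankLocus {m k : ℕ} {x y : Fin m → ℂ} {z : Fin m → Fin k → ℂ}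
    {c : ℂ} (h : ∀ i, x i * y i + ∑ l, z i l ^ 2 = c) :
    hyperbolicGram x y z ∈ symmRankLocus m (k + 2) := by
  have hdiag (i : Fin m) : hyperbolicGram x y z i i = c := by
    rw [← h i]
    simp only [hyperbolicGram, of_apply, sq]
    ring
  refine ⟨?_, ?_, fun i j => by rw [hdiag, hdiag]⟩
  · refine IsSymm.ext fun i j => ?_
    simp only [hyperbolicGram, of_apply]
    congr 1
    · ring
    · exact Finset.sum_congr rfl fun l _ => mul_comm _ _
  · have hmul : hyperbolicGram x y z =
        (Matrix.of fun i => (Fin.cons (x i / 2) (Fin.cons (y i / 2) (z i)) : Fin (k + 2) → ℂ)) *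
        (Matrix.of fun i => (Fin.cons (y i) (Fin.cons (x i) (z i)) : Fin (k + 2) → ℂ))ᵀ := by
      ext i j
      simp only [hyperbolicGram, of_apply, mul_apply, transpose_apply, Fin.sum_univ_succ,
        Fin.cons_zero, Fin.cons_succ]
      ring
    rw [hmul]
    exact (rank_mul_le_left _ _).trans (rank_le_width _)

/-- Over `ℂ` a sum of two squares splits: `a ^ 2 + b ^ 2 = (a + I * b) * (a - I * b)`. -/
theorem exists_hyperbolicGram_eq {m k : ℕ} {A : Matrix (Fin m) (Fin m) ℂ}
    (hA : A ∈ symmRankLocus m (k + 2)) :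
    ∃ (x y : Fin m → ℂ) (z : Fin m → Fin k → ℂ) (c : ℂ),
      hyperbolicGram x y z = A ∧ ∀ i, x i * y i + ∑ l, z i l ^ 2 = c := by
  obtain ⟨hs, hr, hd⟩ := hA
  obtain ⟨V, hV⟩ := hs.exists_gram hr
  obtain ⟨c, hc⟩ : ∃ c, ∀ i, A i i = c := by
    rcases isEmpty_or_nonempty (Fin m) with h | ⟨⟨i⟩⟩
    · exact ⟨0, fun i => h.elim i⟩
    · exact ⟨A i i, fun j => hd j i⟩
  refine ⟨fun i => V 0 i + Complex.I * V 1 i, fun i => V 0 i - Complex.I * V 1 i,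
    fun i l => V l.succ.succ i, c, ?_, fun i => ?_⟩
  · ext i j
    rw [hV, Fin.sum_univ_succ, Fin.sum_univ_succ]
    simp only [hyperbolicGram, of_apply, Fin.succ_zero_eq_one]
    linear_combination (-V 1 i * V 1 j) * Complex.I_sq
  · rw [← hc i, hV, Fin.sum_univ_succ, Fin.sum_univ_succ]
    simp only [Fin.succ_zero_eq_one, ← sq]
    linear_combination (-V 1 i ^ 2) * Complex.I_sq

theorem differentiable_eval_hyperbolicGram {m k : ℕ} {x y : ℂ → Fin m → ℂ}
    {z : ℂ → Fin m → Fin k → ℂ} (hx : ∀ i, Differentiable ℂ fun t => x t i)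
    (hy : ∀ i, Differentiable ℂ fun t => y t i) (hz : ∀ i l, Differentiable ℂ fun t => z t i l)
    (p : MvPolynomial (Fin m × Fin m) ℂ) :
    Differentiable ℂ fun t =>
      MvPolynomial.eval (fun q => hyperbolicGram (x t) (y t) (z t) q.1 q.2) p := by
  induction p using MvPolynomial.induction_on with
  | C a => simp
  | add p q hp hq =>
    simp only [map_add]
    exact hp.add hq
  | mul_X p q hp =>
    simp only [map_mul, MvPolynomial.eval_X]
    refine hp.mul ?_
    simp only [hyperbolicGram, of_apply]
    fun_prop

/-- The product of two nonzero entire functions is nonzero. -/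
theorem Differentiable.exists_ne_zero_and_ne_zero {f g : ℂ → ℂ} (hf : Differentiable ℂ f)
    (hg : Differentiable ℂ g) {a b : ℂ} (ha : f a ≠ 0) (hb : g b ≠ 0) :
    ∃ t, f t ≠ 0 ∧ g t ≠ 0 := by
  by_contra! h
  rcases AnalyticOnNhd.eq_zero_or_eq_zero_of_mul_eq_zero (U := Set.univ)
    (fun z _ => hf.analyticAt z) (fun z _ => hg.analyticAt z)
    (fun z _ => by
      by_cases hz : f z = 0
      · rw [hz, zero_mul]
      · rw [h z hz, mul_zero]) isPreconnected_univ with h | h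
  · exact ha (h a trivial)
  · exact hb (h b trivial)

/-- The points of the locus parametrized by `x i = exp (u i)` are Zariski dense. -/
theorem exists_exp_eval_hyperbolicGram_ne_zero {m k : ℕ} {A : Matrix (Fin m) (Fin m) ℂ}
    (hA : A ∈ symmRankLocus m (k + 2)) {p : MvPolynomial (Fin m × Fin m) ℂ}
    (hp : MvPolynomial.eval (fun q => A q.1 q.2) p ≠ 0) :
    ∃ (u : Fin m → ℂ) (c : ℂ) (z : Fin m → Fin k → ℂ),
      MvPolynomial.eval (fun q => hyperbolicGram (fun i => Complex.exp (u i))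
        (fun i => Complex.exp (-u i) * (c - ∑ l, z i l ^ 2)) z q.1 q.2) p ≠ 0 := by
  obtain ⟨x, y, z, c, rfl, hc⟩ := exists_hyperbolicGram_eq hA
  -- A curve through `(x, y)` raising every product `x i * y i` by the same amount, so that only `c`
  -- changes. The amount is `t ^ 2` so that it factors as `t * t` when `x i = y i = 0`.
  let X (t : ℂ) (i : Fin m) : ℂ :=
    if x i ≠ 0 then x i else if y i ≠ 0 then t ^ 2 / y i else t
  let Y (t : ℂ) (i : Fin m) : ℂ :=
    if x i ≠ 0 then y i + t ^ 2 / x i else if y i ≠ 0 then y i else t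
  have hX0 : X 0 = x := by
    ext i
    simp only [X]
    split_ifs <;> simp_all
  have hY0 : Y 0 = y := by
    ext i
    simp only [Y]
    split_ifs <;> simp_all
  have hX (i) : Differentiable ℂ fun t => X t i := by
    simp only [X]
    split_ifs <;> fun_prop
  have hY (i) : Differentiable ℂ fun t => Y t i := by
    simp only [Y]
    split_ifs <;> fun_prop
  have hXY (t i) : X t i * Y t i = x i * y i + t ^ 2 := by
    simp only [X, Y]
    split_ifs with h1 h2
    · field_simp
    · simp only [ne_eq, not_not] at h1
      rw [h1]
      field_simp
      ring
    · simp only [ne_eq, not_not] at h1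
      rw [h1]
      ring
  have hXne (t i) (ht : t ≠ 0) : X t i ≠ 0 := by
    simp only [X]
    split_ifs with h1 h2
    · exact h1
    · exact div_ne_zero (pow_ne_zero 2 ht) h2
    · exact ht
  -- Taking the identity as the second function forces `t ≠ 0`, hence `X t i ≠ 0`.
  obtain ⟨t, hpt, ht⟩ := Differentiable.exists_ne_zero_and_ne_zero
    (differentiable_eval_hyperbolicGram (z := fun _ => z) hX hY
      (fun _ _ => differentiable_const _) p) differentiable_id
    (a := 0) (b := 1) (by simpa only [hX0, hY0] using hp) one_ne_zero
  refine ⟨fun i => Complex.log (X t i), c + t ^ 2, z, ?_⟩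
  have h1 : (fun i => Complex.exp (Complex.log (X t i))) = X t := by
    ext i
    exact Complex.exp_log (hXne t i ht)
  have h2 : (fun i => Complex.exp (-Complex.log (X t i)) * (c + t ^ 2 - ∑ l, z i l ^ 2)) = Y t := by
    ext i
    rw [Complex.exp_neg, Complex.exp_log (hXne t i ht), ← hc i,
      inv_mul_eq_iff_eq_mul₀ (hXne t i ht), hXY]
    ring
  rw [h1, h2]
  exact hpt

theorem isIrreducible_symmRankLocus (m k : ℕ) :
    @IsIrreducible _ (matrixZariskiTopology m) (symmRankLocus m (k + 2)) := by
  let _ := matrixZariskiTopology m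
  refine ⟨⟨0, isSymm_zero, by simp, fun _ _ => rfl⟩, ?_⟩
  rintro u v hu hv ⟨A, hA, hAu⟩ ⟨B, hB, hBv⟩
  obtain ⟨p, hpA, hpu⟩ := exists_eval_ne_zero_of_mem_open hu hAu
  obtain ⟨q, hqB, hqv⟩ := exists_eval_ne_zero_of_mem_open hv hBv
  obtain ⟨u₀, c₀, z₀, hp⟩ := exists_exp_eval_hyperbolicGram_ne_zero hA hpA
  obtain ⟨u₁, c₁, z₁, hq⟩ := exists_exp_eval_hyperbolicGram_ne_zero hB hqB
  -- The line in parameter space from the first point (`t = 0`) to the second (`t = 1`).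
  let U (t : ℂ) (i : Fin m) : ℂ := u₀ i + t * (u₁ i - u₀ i)
  let Z (t : ℂ) (i : Fin m) (l : Fin k) : ℂ := z₀ i l + t * (z₁ i l - z₀ i l)
  let C (t : ℂ) : ℂ := c₀ + t * (c₁ - c₀)
  let X (t : ℂ) (i : Fin m) : ℂ := Complex.exp (U t i)
  let Y (t : ℂ) (i : Fin m) : ℂ := Complex.exp (-U t i) * (C t - ∑ l, Z t i l ^ 2)
  have hdiff := differentiable_eval_hyperbolicGram (x := X) (y := Y) (z := Z)
    (fun i => by simp only [X, U]; fun_prop) (fun i => by simp only [Y, U, C, Z]; fun_prop)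
    (fun i l => by simp only [Z]; fun_prop)
  obtain ⟨t, hpt, hqt⟩ := (hdiff p).exists_ne_zero_and_ne_zero (hdiff q) (a := 0) (b := 1)
    (by simpa [X, Y, U, C, Z] using hp)
    (by simpa only [X, Y, U, C, Z, one_mul, add_sub_cancel] using hq)
  refine ⟨_, hyperbolicGram_mem_symmRankLocus (c := C t) fun i => ?_, hpu _ hpt, hqv _ hqt⟩
  simp only [X, Y]
  rw [← mul_assoc, ← Complex.exp_add, add_neg_cancel, Complex.exp_zero]
  ring

theorem mainTheorem6 (m n : ℕ) (hn : 2 ≤ n) :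
    IsIrreducibleMatrixVariety (symmRankLocus m n) := by
  obtain ⟨k, rfl⟩ := Nat.exists_eq_add_of_le' hn
  exact ⟨isClosed_symmRankLocus m _, isIrreducible_symmRankLocus m k⟩
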